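/- Let $p>4$ and $\alpha>\tilde p:=\frac{2p-4}{p-4}$. Let $$X=\Big\{u\in H^1(\mathbb R^2):\ \int_{\mathbb R^2}(1+|x|^\alpha)u^2\,dx<+\infty\Big\},\qquad X_r=\{u\in X:\ u \text{ is radial, i.e. } u(x) \text{ depends only on } |x| \text{ (a.e.)}\},$$ where functions are real-valued, and for $q\in\mathbb R$ and $u\in X_r$ put $$I_\alpha(u)=\frac12\int_{\mathbb R^2}|\nabla u|^2dx+\frac12\int_{\mathbb R^2}(1+|x|^\alpha)u^2dx-\frac q4V_0(u)+\frac1p\int_{\mathbb R^2}|u|^pdx,$$ $$V_0(u)=\frac1{2\pi}\int_{\mathbb R^2}\int_{\mathbb R^2}\log|x-y|\,u^2(x)u^2(y)\,dx\,dy .$$ Then all these integrals converge absolutely for every $u\in X_r$, and there exists $\tilde q>0$ (depending on $p$ and $\alpha$) such that, for every $q\ge\tilde q$, $$\inf_{u\in X_r}I_\alpha(u)\in(-\infty,0).$$ -/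

import Mathlib

open MeasureTheory
open scoped ContDiff Gradient

noncomputable section

namespace PlanarSchrodingerMaxwell

/-- The Euclidean plane. -/
abbrev Plane : Type := EuclideanSpace ℝ (Fin 2)

/-- `g` is a weak (distributional) gradient of `u`: both are locally integrable and
`∫ u ∇φ = - ∫ φ g` for every real test function `φ ∈ C_c^∞`. -/
def HasWeakGradient (u : Plane → ℝ) (g : Plane → Plane) : Prop :=
  LocallyIntegrable u ∧ LocallyIntegrable g ∧
    ∀ φ : Plane → ℝ, ContDiff ℝ ∞ φ → HasCompactSupport φ →
      ∫ x, u x • ∇ φ x = - ∫ x, φ x • g x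

/-- Weak gradients are unique up to null sets. -/
theorem HasWeakGradient.ae_eq {u : Plane → ℝ} {g h : Plane → Plane}
    (hg : HasWeakGradient u g) (hh : HasWeakGradient u h) : g =ᵐ[volume] h :=
  ae_eq_of_integral_contDiff_smul_eq hg.2.1 hh.2.1 fun φ hφ hc =>
    neg_injective ((hg.2.2 φ hφ hc).symm.trans (hh.2.2 φ hφ hc))

open Classical in
/-- The weak gradient of `u`, well defined up to null sets whenever `u` has one
(and `0` by convention otherwise). -/
def weakGradient (u : Plane → ℝ) : Plane → Plane :=
  if h : ∃ g, HasWeakGradient u g then h.choose else 0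

theorem HasWeakGradient.weakGradient_ae_eq {u : Plane → ℝ} {g : Plane → Plane}
    (hg : HasWeakGradient u g) : weakGradient u =ᵐ[volume] g := by
  have h : ∃ g, HasWeakGradient u g := ⟨g, hg⟩
  simp only [weakGradient, dif_pos h]
  exact h.choose_spec.ae_eq hg

/-- `u ∈ H¹(ℝ²)`: `u ∈ L²` has a weak gradient which is in `L²`. Functions are taken as
representatives of their almost everywhere classes. -/
def MemH1 (u : Plane → ℝ) : Prop :=
  MemLp u 2 ∧ ∃ g, HasWeakGradient u g ∧ MemLp g 2

/-- The space `X` of all `u ∈ H¹(ℝ²)` with `∫ (1 + |x|^α) u² < ∞`. -/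
def X (α : ℝ) : Set (Plane → ℝ) :=
  {u | MemH1 u ∧ Integrable fun x => (1 + ‖x‖ ^ α) * u x ^ 2}

/-- The radial functions in `X`; as usual for elements of a Lebesgue space, `u(x)` depends only
on `|x|` up to a null set. -/
def Xr (α : ℝ) : Set (Plane → ℝ) :=
  {u | u ∈ X α ∧ ∃ v : ℝ → ℝ, ∀ᵐ x, u x = v ‖x‖}

/-- The logarithmic interaction `V₀(u) = (1/2π) ∬ log|x - y| u²(x) u²(y) dx dy`. -/
def V₀ (u : Plane → ℝ) : ℝ :=
  1 / (2 * Real.pi) *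
    ∫ z : Plane × Plane, Real.log ‖z.1 - z.2‖ * u z.1 ^ 2 * u z.2 ^ 2

/-- The functional `I_α`, with its dependence on the exponent `p` and the coupling `q`
made explicit. -/
def I (p q α : ℝ) (u : Plane → ℝ) : ℝ :=
  1 / 2 * (∫ x, ‖weakGradient u x‖ ^ 2) + 1 / 2 * (∫ x, (1 + ‖x‖ ^ α) * u x ^ 2)
    - q / 4 * V₀ u + 1 / p * ∫ x, |u x| ^ p

end PlanarSchrodingerMaxwell

end

namespace PlanarSchrodingerMaxwell

open Filter Topology
open scoped ENNReal NNReal Convolution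

/-! ### Cauchy-Schwarz and Young inequalities for lower integrals -/

/-! Lower bound: for small `δ > 0`, `log|x-y| ≤ δ⁻¹ (1+|x|)^δ (1+|y|)^δ`, so `V₀ u` is at most a
constant times `T²`, where `T = ∫ (1+|x|)^δ u²`. Since `(1+|x|)^(-(2+δ))` is integrable on the
plane, Cauchy-Schwarz bounds `T²` by a multiple of `∫ (1+|x|)^(2+3δ) u⁴`. A Young-type pointwise
inequality (`exists_pow_four_le`) absorbs this integrand into `(1+|x|^α) u²/2 + |u|^p/p`, up to a
bounded function supported in a disc. With weight exponent `β`, absorption requires `β(p-2)/(p-4) <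
α`; at `β = 2` this is exactly `α > (2p-4)/(p-4)`, and the strict inequality leaves room for `β =
2+3δ`.

Negativity: `I` is affine in `q` with slope `-V₀ u / 4`, so one function with `V₀ u > 0` suffices.
Dilating a bump by `L` adds a multiple of `log L` to its interaction, up to a positive factor
(`exists_mem_Xr_V₀_pos`).

Absolute convergence: the singularity of the logarithm is controlled by an integrable kernel and `u
∈ L⁴`, and the power term by `u ∈ L^p`. Both come from the embedding of `H¹` into `L^(2k)`, obtained
by mollifying, cutting off and applying Fatou's lemma (`MemH1.lintegral_enorm_pow_ne_top`). -/

theorem lintegral_mul_sq_le {β : Type*} [MeasurableSpace β] (μ : Measure β) {f g : β → ℝ≥0∞}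
    (hf : AEMeasurable f μ) (hg : AEMeasurable g μ) :
    (∫⁻ x, f x * g x ∂μ) ^ 2 ≤ (∫⁻ x, f x ^ 2 ∂μ) * ∫⁻ x, g x ^ 2 ∂μ := by
  have h := ENNReal.lintegral_mul_le_Lp_mul_Lq μ Real.HolderConjugate.two_two hf hg
  have hsq : ∀ a : ℝ≥0∞, (a ^ (1 / 2 : ℝ)) ^ 2 = a := fun a => by
    rw [← ENNReal.rpow_natCast, ← ENNReal.rpow_mul]; norm_num
  simp only [ENNReal.rpow_two, Pi.mul_apply] at h
  calc (∫⁻ x, f x * g x ∂μ) ^ 2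
      ≤ ((∫⁻ x, f x ^ 2 ∂μ) ^ (1 / 2 : ℝ) * (∫⁻ x, g x ^ 2 ∂μ) ^ (1 / 2 : ℝ)) ^ 2 := by
        gcongr
    _ = _ := by rw [mul_pow, hsq, hsq]

/-- Cauchy-Schwarz against the constant `1` for the probability measure `φ dt`, then Tonelli and
translation invariance. -/
theorem lintegral_sq_convolution_le {φ f : Plane → ℝ≥0∞} (hφ : Measurable φ)
    (hφ1 : ∫⁻ t, φ t = 1) (hf : AEMeasurable f) :
    ∫⁻ x, (∫⁻ t, φ t * f (x - t)) ^ 2 ≤ ∫⁻ x, f x ^ 2 := by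
  have hmeas : ∀ x : Plane, AEMeasurable fun t => f (x - t) := fun x =>
    hf.comp_quasiMeasurePreserving (quasiMeasurePreserving_sub_left volume x)
  have hmeas2 : AEMeasurable (fun z : Plane × Plane => f (z.1 - z.2)) (volume.prod volume) :=
    hf.comp_quasiMeasurePreserving (quasiMeasurePreserving_sub volume volume)
  have key : ∀ x, (∫⁻ t, φ t * f (x - t)) ^ 2 ≤ ∫⁻ t, φ t * f (x - t) ^ 2 := by
    intro x
    set ν := (volume : Measure Plane).withDensity φ
    have hac : ν ≪ volume := withDensity_absolutelyContinuous _ _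
    have h := lintegral_mul_sq_le ν ((hmeas x).mono_ac hac) (aemeasurable_const (b := (1 : ℝ≥0∞)))
    have hν : ν Set.univ = 1 := by simp [ν, hφ1]
    simp only [mul_one, one_pow, lintegral_const, hν] at h
    rw [lintegral_withDensity_eq_lintegral_mul₀ hφ.aemeasurable (hmeas x),
      lintegral_withDensity_eq_lintegral_mul₀ hφ.aemeasurable ((hmeas x).pow_const 2)] at h
    exact h
  calc ∫⁻ x, (∫⁻ t, φ t * f (x - t)) ^ 2 ≤ ∫⁻ x, ∫⁻ t, φ t * f (x - t) ^ 2 :=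
        lintegral_mono key
    _ = ∫⁻ t, ∫⁻ x, φ t * f (x - t) ^ 2 :=
        lintegral_lintegral_swap (by
          exact (hφ.comp measurable_snd).aemeasurable.mul (hmeas2.pow_const 2))
    _ = ∫⁻ t, φ t * ∫⁻ x, f x ^ 2 := by
        congr with t
        have hm : AEMeasurable fun x => f (x - t) := hf.comp_quasiMeasurePreserving
          (measurePreserving_sub_right volume t).quasiMeasurePreserving
        rw [lintegral_const_mul'' _ (hm.pow_const 2),
          lintegral_sub_right_eq_self (fun x => f x ^ 2) t]
    _ = ∫⁻ x, f x ^ 2 := by rw [lintegral_mul_const _ hφ, hφ1, one_mul]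

/-! ### The Sobolev inequality for `C¹` functions with compact support -/

/-- The Gagliardo-Nirenberg-Sobolev inequality `‖w‖₂ ≤ C ‖Dw‖₁` of the plane, applied to `w =
v^(m+1)`; Cauchy-Schwarz then splits `|v|^m |Dv|`. Each use gains two powers, so induction from `L²`
reaches every even exponent. -/
theorem exists_lintegral_pow_le : ∃ C : ℝ≥0, ∀ v : Plane → ℝ, ContDiff ℝ 1 v →
    HasCompactSupport v → ∀ m : ℕ, ∫⁻ x, ‖v x‖ₑ ^ (2 * (m + 1)) ≤
      C * (m + 1) ^ 2 * (∫⁻ x, ‖v x‖ₑ ^ (2 * m)) * ∫⁻ x, ‖fderiv ℝ v x‖ₑ ^ 2 := by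
  refine ⟨lintegralPowLePowLIntegralFDerivConst (volume : Measure Plane) 2,
    fun v hv hc m => ?_⟩
  have hp : Real.HolderConjugate (Module.finrank ℝ Plane) 2 := by
    simpa using Real.HolderConjugate.two_two
  have hc' : HasCompactSupport fun x => v x ^ (m + 1) :=
    hc.comp_left (g := fun t => t ^ (m + 1)) (by simp)
  have h := lintegral_pow_le_pow_lintegral_fderiv (volume : Measure Plane) (hv.pow (m + 1)) hc' hp
  simp only [ENNReal.rpow_two, enorm_pow, ← pow_mul] at h
  have hd : ∀ x, ‖fderiv ℝ (fun x => v x ^ (m + 1)) x‖ₑ =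
      (m + 1) * (‖v x‖ₑ ^ m * ‖fderiv ℝ v x‖ₑ) := by
    intro x
    rw [((hv.differentiable one_ne_zero x).hasFDerivAt.pow (m + 1)).fderiv,
      ← Nat.cast_smul_eq_nsmul ℝ, smul_assoc, enorm_smul, enorm_smul, enorm_pow]
    have : ‖((m + 1 : ℕ) : ℝ)‖ₑ = (m : ℝ≥0∞) + 1 := by
      rw [Real.enorm_of_nonneg (by positivity), ENNReal.ofReal_natCast]; push_cast; rfl
    rw [this]; simp
  have hm1 : AEMeasurable fun x => ‖v x‖ₑ ^ m :=
    (hv.continuous.measurable.enorm.pow_const m).aemeasurable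
  have hm2 : AEMeasurable fun x => ‖fderiv ℝ v x‖ₑ :=
    ((hv.continuous_fderiv one_ne_zero).measurable.enorm).aemeasurable
  have hcs := lintegral_mul_sq_le volume hm1 hm2
  simp only [hd] at h
  rw [lintegral_const_mul'' _ (by exact hm1.mul hm2), mul_pow] at h
  simp only [← pow_mul, mul_comm m 2] at hcs
  calc _ = _ := by rw [mul_comm 2 (m + 1)]
    _ ≤ _ := h
    _ ≤ _ := by
      rw [mul_assoc, mul_assoc]; gcongr

theorem exists_lintegral_pow_le_of_bounds (m : ℕ) {A B : ℝ≥0∞} (hA : A ≠ ⊤) (hB : B ≠ ⊤) :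
    ∃ K : ℝ≥0∞, K ≠ ⊤ ∧ ∀ v : Plane → ℝ, ContDiff ℝ 1 v → HasCompactSupport v →
      ∫⁻ x, ‖v x‖ₑ ^ 2 ≤ A → ∫⁻ x, ‖fderiv ℝ v x‖ₑ ^ 2 ≤ B →
      ∫⁻ x, ‖v x‖ₑ ^ (2 * (m + 1)) ≤ K := by
  obtain ⟨C, hC⟩ := exists_lintegral_pow_le
  induction m with
  | zero => exact ⟨A, hA, fun v _ _ h _ => by simpa using h⟩
  | succ m ih =>
    obtain ⟨K, hK, ih⟩ := ih
    refine ⟨C * ((m + 1 : ℕ) + 1) ^ 2 * K * B, by finiteness, fun v hv hc h1 h2 => ?_⟩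
    refine (hC v hv hc (m + 1)).trans ?_
    gcongr
    exact ih v hv hc h1 h2

/-! ### A radial bump function -/

/-- A smooth radial function equal to `1` on the unit ball and supported in the disc of
radius `√2`. -/
noncomputable def bump (x : Plane) : ℝ := Real.smoothTransition (2 - ‖x‖ ^ 2)

theorem contDiff_bump : ContDiff ℝ ∞ bump :=
  Real.smoothTransition.contDiff.comp (contDiff_const.sub (contDiff_norm_sq ℝ))

theorem bump_nonneg (x : Plane) : 0 ≤ bump x := Real.smoothTransition.nonneg _

theorem bump_le_one (x : Plane) : bump x ≤ 1 := Real.smoothTransition.le_one _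

theorem bump_eq_one {x : Plane} (hx : ‖x‖ ≤ 1) : bump x = 1 :=
  Real.smoothTransition.one_of_one_le (by nlinarith [norm_nonneg x])

theorem hasCompactSupport_bump : HasCompactSupport bump := by
  refine HasCompactSupport.intro (isCompact_closedBall (0 : Plane) 2) fun x hx => ?_
  rw [Metric.mem_closedBall, dist_zero_right, not_le] at hx
  exact Real.smoothTransition.zero_of_nonpos (by nlinarith)

theorem exists_norm_fderiv_bump_le : ∃ D : ℝ, ∀ x, ‖fderiv ℝ bump x‖ ≤ D := by
  exact (hasCompactSupport_bump.fderiv ℝ).exists_bound_of_continuous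
    (contDiff_bump.continuous_fderiv (by simp))

/-! ### Mollification of weakly differentiable functions -/

theorem lintegral_enorm_normed (φ : ContDiffBump (0 : Plane)) :
    ∫⁻ t, ‖φ.normed volume t‖ₑ = 1 := by
  rw [lintegral_enorm_of_nonneg φ.nonneg_normed,
    ← ofReal_integral_eq_lintegral_ofReal φ.integrable_normed (ae_of_all _ φ.nonneg_normed),
    φ.integral_normed, ENNReal.ofReal_one]

theorem contDiff_mollify (φ : ContDiffBump (0 : Plane)) {u : Plane → ℝ}
    (hu : LocallyIntegrable u) :
    ContDiff ℝ 1 (φ.normed volume ⋆[ContinuousLinearMap.lsmul ℝ ℝ, volume] u) :=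
  φ.hasCompactSupport_normed.contDiff_convolution_left _ φ.contDiff_normed hu

theorem enorm_mollify_le (φ : ContDiffBump (0 : Plane)) (u : Plane → ℝ) (x : Plane) :
    ‖(φ.normed volume ⋆[ContinuousLinearMap.lsmul ℝ ℝ, volume] u) x‖ₑ ≤
      ∫⁻ t, ‖φ.normed volume t‖ₑ * ‖u (x - t)‖ₑ := by
  refine (enorm_integral_le_lintegral_enorm _).trans_eq ?_
  simp [enorm_mul]

/-- The derivative falls on the mollifier, and testing the weak gradient against `y ↦ f (x - y)`
moves it onto `u`: the gradient of the mollification is the mollification of `g`. -/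
theorem enorm_fderiv_mollify_le (φ : ContDiffBump (0 : Plane)) {u : Plane → ℝ}
    {g : Plane → Plane} (h : HasWeakGradient u g) (x : Plane) :
    ‖fderiv ℝ (φ.normed volume ⋆[ContinuousLinearMap.lsmul ℝ ℝ, volume] u) x‖ₑ ≤
      ∫⁻ t, ‖φ.normed volume t‖ₑ * ‖g (x - t)‖ₑ := by
  set f : Plane → ℝ := φ.normed volume with hf
  have hfs : ContDiff ℝ ∞ f := φ.contDiff_normed
  have hfc : HasCompactSupport f := φ.hasCompactSupport_normed
  set ψ : Plane → ℝ := fun y => f (x - y) with hψ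
  have hψs : ContDiff ℝ ∞ ψ := hfs.comp (contDiff_const.sub contDiff_id)
  have hψc : HasCompactSupport ψ :=
    hfc.comp_homeomorph (Homeomorph.subLeft x)
  have hDψ : ∀ y, fderiv ℝ ψ y = - fderiv ℝ f (x - y) := by
    intro y
    have h1 := ((hfs.differentiable (by simp)) (x - y)).hasFDerivAt.comp y
      ((hasFDerivAt_const x y).sub (hasFDerivAt_id y))
    have := h1.fderiv
    simpa [Function.comp_def] using! this
  have hcont : Continuous (fderiv ℝ ψ) := hψs.continuous_fderiv (by simp)
  have hint : Integrable fun y => u y • fderiv ℝ ψ y :=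
    h.1.integrable_smul_right_of_hasCompactSupport hcont (hψc.fderiv ℝ)
  have hint' : Integrable fun y => u y • ∇ ψ y :=
    h.1.integrable_smul_right_of_hasCompactSupport
      ((InnerProductSpace.toDual ℝ Plane).symm.continuous.comp hcont)
      ((hψc.fderiv ℝ).comp_left (map_zero _))
  have hw := h.2.2 ψ hψs hψc
  have hD : fderiv ℝ (f ⋆[ContinuousLinearMap.lsmul ℝ ℝ, volume] u) x =
      innerSL ℝ (∫ y, ψ y • g y) := by
    rw [(hfc.hasFDerivAt_convolution_left _ (hfs.of_le (by simp)) h.1 x).fderiv]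
    have h1 : (fderiv ℝ f ⋆[(ContinuousLinearMap.lsmul ℝ ℝ).precompL Plane, volume] u) x =
        - ∫ y, u y • fderiv ℝ ψ y := by
      rw [convolution_def, ← integral_sub_left_eq_self _ volume x, ← integral_neg]
      congr with y e
      simp [hDψ, ContinuousLinearMap.precompL_apply, mul_comm]
    rw [h1, ← neg_eq_iff_eq_neg.mpr hw]
    ext e
    have h2 : innerSL ℝ (-∫ y, u y • ∇ ψ y) e = - ∫ y, inner ℝ (u y • ∇ ψ y) e := by
      simp only [innerSL_apply_apply, inner_neg_left]
      congr 1
      rw [real_inner_comm, ← integral_inner hint']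
      simp only [real_inner_comm]
    rw [neg_apply, ContinuousLinearMap.integral_apply hint, h2]
    congr 2 with y
    simp [inner_smul_left, gradient]
  rw [hD]
  have h3 : ‖innerSL ℝ (∫ y, ψ y • g y)‖ₑ = ‖∫ y, ψ y • g y‖ₑ := by
    rw [← ofReal_norm, ← ofReal_norm, innerSL_apply_norm]
  rw [h3, ← integral_sub_left_eq_self _ volume x]
  refine (enorm_integral_le_lintegral_enorm _).trans_eq ?_
  simp [hψ, enorm_smul]

/-! ### The Sobolev embedding of `H¹` -/

theorem lintegral_enorm_sq_ne_top {F : Type*} [NormedAddCommGroup F] {f : Plane → F}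
    (hf : MemLp f 2) : ∫⁻ x, ‖f x‖ₑ ^ 2 ≠ ⊤ := by
  have := (lintegral_rpow_enorm_lt_top_of_eLpNorm_lt_top two_ne_zero ENNReal.ofNat_ne_top
    hf.eLpNorm_lt_top).ne
  simpa using this

theorem ennreal_add_sq_le (a b : ℝ≥0∞) : (a + b) ^ 2 ≤ 2 * (a ^ 2 + b ^ 2) := by
  have := ENNReal.rpow_add_le_mul_rpow_add_rpow a b (p := 2) (by norm_num)
  norm_num at this
  exact this

/-- The product of the mollification of `u` with a dilated bump function. -/
noncomputable def cutoffMollify (R : ℝ) (φ : ContDiffBump (0 : Plane)) (u : Plane → ℝ)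
    (x : Plane) : ℝ :=
  bump (R⁻¹ • x) * (φ.normed volume ⋆[ContinuousLinearMap.lsmul ℝ ℝ, volume] u) x

theorem contDiff_cutoffMollify (R : ℝ) (φ : ContDiffBump (0 : Plane)) {u : Plane → ℝ}
    (hu : LocallyIntegrable u) : ContDiff ℝ 1 (cutoffMollify R φ u) :=
  ((contDiff_bump.comp (contDiff_const_smul R⁻¹)).of_le (by simp)).mul (contDiff_mollify φ hu)

theorem hasCompactSupport_cutoffMollify {R : ℝ} (hR : R ≠ 0) (φ : ContDiffBump (0 : Plane))
    (u : Plane → ℝ) : HasCompactSupport (cutoffMollify R φ u) :=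
  (hasCompactSupport_bump.comp_smul (inv_ne_zero hR)).mul_right

theorem enorm_cutoffMollify_le (R : ℝ) (φ : ContDiffBump (0 : Plane)) (u : Plane → ℝ)
    (x : Plane) : ‖cutoffMollify R φ u x‖ₑ ≤ ∫⁻ t, ‖φ.normed volume t‖ₑ * ‖u (x - t)‖ₑ := by
  refine le_trans ?_ (enorm_mollify_le φ u x)
  rw [cutoffMollify, enorm_mul]
  refine mul_le_of_le_one_left' ?_
  rw [Real.enorm_of_nonneg (bump_nonneg _)]
  exact ENNReal.ofReal_le_one.mpr (bump_le_one _)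

/-- Product rule; since `R ≥ 1`, the cutoff contributes a derivative bounded by `D` uniformly in
`R`. -/
theorem enorm_fderiv_cutoffMollify_le {R D : ℝ} (hR : 1 ≤ R) (hD : ∀ x, ‖fderiv ℝ bump x‖ ≤ D)
    (φ : ContDiffBump (0 : Plane)) {u : Plane → ℝ} {g : Plane → Plane}
    (h : HasWeakGradient u g) (x : Plane) :
    ‖fderiv ℝ (cutoffMollify R φ u) x‖ₑ ≤ (∫⁻ t, ‖φ.normed volume t‖ₑ * ‖g (x - t)‖ₑ) +
      ENNReal.ofReal D * ∫⁻ t, ‖φ.normed volume t‖ₑ * ‖u (x - t)‖ₑ := by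
  set w := φ.normed volume ⋆[ContinuousLinearMap.lsmul ℝ ℝ, volume] u with hw
  have hb : HasFDerivAt (fun x => bump (R⁻¹ • x)) (R⁻¹ • fderiv ℝ bump (R⁻¹ • x)) x := by
    have h1 := ((contDiff_bump.differentiable (by simp)) (R⁻¹ • x)).hasFDerivAt.comp x
      ((hasFDerivAt_id x).const_smul R⁻¹)
    convert! h1 using 1
    ext; simp
  have hwd := ((contDiff_mollify φ h.1).differentiable one_ne_zero x).hasFDerivAt
  have hd := (hb.mul hwd).fderiv
  change fderiv ℝ (cutoffMollify R φ u) x = _ at hd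
  rw [hd]
  have htri : ∀ a b : Plane →L[ℝ] ℝ, ‖a + b‖ₑ ≤ ‖a‖ₑ + ‖b‖ₑ := fun a b => enorm_add_le a b
  refine (htri _ _).trans (add_le_add ?_ ?_)
  · rw [enorm_smul]
    refine le_trans (mul_le_of_le_one_left' ?_) (enorm_fderiv_mollify_le φ h x)
    rw [Real.enorm_of_nonneg (bump_nonneg _)]
    exact ENNReal.ofReal_le_one.mpr (bump_le_one _)
  · rw [enorm_smul, mul_comm]
    gcongr
    · rw [← ofReal_norm]
      gcongr
      rw [norm_smul, norm_inv, Real.norm_of_nonneg (by linarith)]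
      exact (mul_le_of_le_one_left (norm_nonneg _) (inv_le_one_of_one_le₀ hR)).trans (hD _)
    · exact enorm_mollify_le φ u x

theorem MemH1.lintegral_enorm_pow_ne_top {u : Plane → ℝ} (hu : MemH1 u) (m : ℕ) :
    ∫⁻ x, ‖u x‖ₑ ^ (2 * (m + 1)) ≠ ⊤ := by
  obtain ⟨hu2, g, hg, hg2⟩ := hu
  obtain ⟨D, hD⟩ := exists_norm_fderiv_bump_le
  have hA := lintegral_enorm_sq_ne_top hu2
  have hB := lintegral_enorm_sq_ne_top hg2
  set A := ∫⁻ x, ‖u x‖ₑ ^ 2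
  set B := ∫⁻ x, ‖g x‖ₑ ^ 2
  obtain ⟨K, hK, hbound⟩ := exists_lintegral_pow_le_of_bounds m hA
    (show 2 * (B + ENNReal.ofReal D ^ 2 * A) ≠ ⊤ by finiteness)
  -- The fixed ratio `2` of outer to inner radius is what the almost everywhere convergence of the
  -- mollifications needs.
  let φ : ℕ → ContDiffBump (0 : Plane) := fun n =>
    ⟨((n : ℝ) + 1)⁻¹, 2 * ((n : ℝ) + 1)⁻¹, by positivity, by
      have : 0 < ((n : ℝ) + 1)⁻¹ := by positivity
      linarith⟩
  have hφ0 : Tendsto (fun n => (φ n).rOut) atTop (𝓝 0) := by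
    have := (tendsto_one_div_add_atTop_nhds_zero_nat (𝕜 := ℝ)).const_mul 2
    simpa [φ] using this
  let v : ℕ → Plane → ℝ := fun n => cutoffMollify (n + 1) (φ n) u
  have hlim : ∀ᵐ x, Tendsto (fun n => v n x) atTop (𝓝 (u x)) := by
    filter_upwards [ContDiffBump.ae_convolution_tendsto_right_of_locallyIntegrable (K := 2) hφ0
      (Eventually.of_forall fun n => le_rfl) hg.1] with x hx
    refine hx.congr' ?_
    filter_upwards [eventually_ge_atTop ⌈‖x‖⌉₊] with n hn
    have : ‖x‖ ≤ n := Nat.ceil_le.mp hn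
    simp only [v, cutoffMollify]
    rw [bump_eq_one, one_mul]
    rw [norm_smul, norm_inv, Real.norm_of_nonneg (by positivity), inv_mul_le_iff₀ (by positivity)]
    linarith
  have hv1 : ∀ n, ContDiff ℝ 1 (v n) := fun n => contDiff_cutoffMollify _ _ hg.1
  have hφm : ∀ n, Measurable fun t => ‖(φ n).normed volume t‖ₑ := fun n =>
    (φ n).continuous_normed.measurable.enorm
  have hum : AEMeasurable fun x => ‖u x‖ₑ := hu2.1.enorm
  have hgm : AEMeasurable fun x => ‖g x‖ₑ := hg2.1.enorm
  have hcu := fun n => lintegral_sq_convolution_le (hφm n) (lintegral_enorm_normed (φ n)) hum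
  have hcg := fun n => lintegral_sq_convolution_le (hφm n) (lintegral_enorm_normed (φ n)) hgm
  have hvK : ∀ n, ∫⁻ x, ‖v n x‖ₑ ^ (2 * (m + 1)) ≤ K := by
    intro n
    refine hbound (v n) (hv1 n) (hasCompactSupport_cutoffMollify (by positivity) _ _) ?_ ?_
    · refine le_trans (lintegral_mono fun x => ?_) (hcu n)
      exact pow_le_pow_left' (enorm_cutoffMollify_le _ _ _ _) 2
    · have hmeas : AEMeasurable fun x => ∫⁻ t, ‖(φ n).normed volume t‖ₑ * ‖u (x - t)‖ₑ := by
        refine AEMeasurable.lintegral_prod_right'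
          (f := fun z : Plane × Plane => ‖(φ n).normed volume z.2‖ₑ * ‖u (z.1 - z.2)‖ₑ) ?_
        exact ((hφm n).comp measurable_snd).aemeasurable.mul
          (hum.comp_quasiMeasurePreserving (quasiMeasurePreserving_sub volume volume))
      calc ∫⁻ x, ‖fderiv ℝ (v n) x‖ₑ ^ 2
          ≤ ∫⁻ x, 2 * ((∫⁻ t, ‖(φ n).normed volume t‖ₑ * ‖g (x - t)‖ₑ) ^ 2 +
              ENNReal.ofReal D ^ 2 * (∫⁻ t, ‖(φ n).normed volume t‖ₑ * ‖u (x - t)‖ₑ) ^ 2) := by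
            refine lintegral_mono fun x => ?_
            refine (pow_le_pow_left' (enorm_fderiv_cutoffMollify_le (by simp) hD (φ n) hg x)
              2).trans ((ennreal_add_sq_le _ _).trans_eq ?_)
            rw [mul_pow]
        _ = 2 * ((∫⁻ x, (∫⁻ t, ‖(φ n).normed volume t‖ₑ * ‖g (x - t)‖ₑ) ^ 2) +
              ENNReal.ofReal D ^ 2 *
                ∫⁻ x, (∫⁻ t, ‖(φ n).normed volume t‖ₑ * ‖u (x - t)‖ₑ) ^ 2) := by
            rw [lintegral_const_mul' _ _ (by simp), lintegral_add_right' _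
              ((hmeas.pow_const 2).const_mul _), lintegral_const_mul' _ _ (by finiteness)]
        _ ≤ 2 * (B + ENNReal.ofReal D ^ 2 * A) := by
            gcongr
            · exact hcg n
            · exact hcu n
  refine ne_top_of_le_ne_top hK ?_
  calc ∫⁻ x, ‖u x‖ₑ ^ (2 * (m + 1))
      = ∫⁻ x, liminf (fun n => ‖v n x‖ₑ ^ (2 * (m + 1))) atTop := by
        refine lintegral_congr_ae ?_
        filter_upwards [hlim] with x hx
        exact ((ENNReal.continuous_pow _).tendsto _ |>.comp
          (hx.enorm)).liminf_eq.symm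
    _ ≤ liminf (fun n => ∫⁻ x, ‖v n x‖ₑ ^ (2 * (m + 1))) atTop :=
        lintegral_liminf_le fun n => (hv1 n).continuous.measurable.enorm.pow_const _
    _ ≤ K := by
        refine (liminf_le_liminf (Eventually.of_forall hvK)).trans_eq ?_
        simp

theorem MemH1.integrable_rpow {u : Plane → ℝ} (hu : MemH1 u) {p : ℝ} (hp : 2 ≤ p) :
    Integrable fun x => |u x| ^ p := by
  obtain ⟨m, hm⟩ := exists_nat_ge p
  have hmeas : AEStronglyMeasurable u volume := hu.1.1
  have h2 : Integrable fun x => |u x| ^ 2 := by simpa using hu.1.integrable_sq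
  have hN : Integrable fun x => |u x| ^ (2 * (m + 1)) := by
    refine ⟨by fun_prop, ?_⟩
    rw [hasFiniteIntegral_iff_enorm]
    refine lt_top_iff_ne_top.mpr ?_
    simpa [enorm_pow] using hu.lintegral_enorm_pow_ne_top m
  -- Interpolation: `|u|^p ≤ |u|² + |u|^(2(m+1))`, the first term serving where `|u| ≤ 1`, the
  -- second elsewhere.
  refine (h2.add hN).mono' (hmeas.norm.aemeasurable.pow_const p).aestronglyMeasurable
    (ae_of_all _ fun x => ?_)
  rw [Real.norm_of_nonneg (by positivity), Pi.add_apply]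
  have h0 := abs_nonneg (u x)
  rcases le_total |u x| 1 with h1 | h1
  · have : |u x| ^ p ≤ |u x| ^ (2 : ℝ) := Real.rpow_le_rpow_of_exponent_ge' h0 h1 (by norm_num) hp
    rw [Real.rpow_two] at this
    exact this.trans (le_add_of_nonneg_right (by positivity))
  · have : |u x| ^ p ≤ |u x| ^ ((2 * (m + 1) : ℕ) : ℝ) :=
      Real.rpow_le_rpow_of_exponent_le h1 (by push_cast; linarith)
    rw [Real.rpow_natCast] at this
    exact this.trans (le_add_of_nonneg_left (by positivity))

/-! ### The logarithmic interaction -/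

theorem norm_sub_le_mul (x y : Plane) : ‖x - y‖ ≤ (1 + ‖x‖) * (1 + ‖y‖) := by
  have := norm_sub_le x y
  nlinarith [norm_nonneg x, norm_nonneg y, mul_nonneg (norm_nonneg x) (norm_nonneg y)]

theorem one_add_rpow_le {s α r : ℝ} (hs : 0 ≤ s) (hsα : s ≤ α) (hr : 0 ≤ r) :
    (1 + r) ^ s ≤ 2 ^ s * (1 + r ^ α) := by
  have hα : 0 ≤ r ^ α := Real.rpow_nonneg hr α
  rcases le_total r 1 with h | h
  · calc (1 + r) ^ s ≤ 2 ^ s := Real.rpow_le_rpow (by positivity) (by linarith) hs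
      _ ≤ 2 ^ s * (1 + r ^ α) := le_mul_of_one_le_right (by positivity) (by linarith)
  · calc (1 + r) ^ s ≤ (2 * r) ^ s := Real.rpow_le_rpow (by positivity) (by linarith) hs
      _ = 2 ^ s * r ^ s := Real.mul_rpow (by norm_num) hr
      _ ≤ 2 ^ s * (1 + r ^ α) := by
        gcongr
        exact (Real.rpow_le_rpow_of_exponent_le h hsα).trans (by linarith)

theorem integrable_one_add_norm_rpow_mul_sq {α s : ℝ} (hs : 0 ≤ s) (hsα : s ≤ α) {u : Plane → ℝ}
    (hu : u ∈ X α) : Integrable fun x => (1 + ‖x‖) ^ s * u x ^ 2 := by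
  have hm : AEStronglyMeasurable u volume := hu.1.1.1
  refine (hu.2.const_mul (2 ^ s)).mono' ?_ (ae_of_all _ fun x => ?_)
  · exact (by fun_prop : Measurable fun x : Plane => (1 + ‖x‖) ^ s).aestronglyMeasurable.mul
      (hm.pow 2)
  · rw [Real.norm_of_nonneg (by positivity), ← mul_assoc]
    gcongr
    exact one_add_rpow_le hs hsα (norm_nonneg x)

/-- The singular part of a majorant of the logarithm. -/
noncomputable def logKernel (x : Plane) : ℝ := (Set.Iio (1 : ℝ)).indicator (fun r => r⁻¹) ‖x‖

theorem logKernel_nonneg (x : Plane) : 0 ≤ logKernel x :=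
  Set.indicator_apply_nonneg fun _ => by positivity

theorem logKernel_neg (x : Plane) : logKernel (-x) = logKernel x := by simp [logKernel]

/-- In polar coordinates the Jacobian `r` cancels `r⁻¹`. -/
theorem integrable_logKernel : Integrable logKernel := by
  unfold logKernel
  rw [integrable_fun_norm_addHaar volume (f := (Set.Iio (1 : ℝ)).indicator (fun r => r⁻¹))]
  have h : IntegrableOn ((Set.Iio (1 : ℝ)).indicator fun _ => (1 : ℝ)) (Set.Ioi 0) := by
    rw [IntegrableOn, integrable_indicator_iff measurableSet_Iio, IntegrableOn,
      Measure.restrict_restrict measurableSet_Iio]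
    simp [Set.Iio_inter_Ioi]
  refine h.congr_fun (fun r hr => ?_) measurableSet_Ioi
  have hr' : r ≠ 0 := (Set.mem_Ioi.mp hr).ne'
  by_cases h1 : r ∈ Set.Iio (1 : ℝ) <;> simp [h1, hr']

theorem abs_log_norm_sub_le (x y : Plane) :
    |Real.log ‖x - y‖| ≤ (1 + ‖x‖) * (1 + ‖y‖) + logKernel (x - y) := by
  rcases le_or_gt 1 ‖x - y‖ with h | h
  · rw [abs_of_nonneg (Real.log_nonneg h)]
    have := Real.log_le_self (norm_nonneg (x - y))
    linarith [norm_sub_le_mul x y, logKernel_nonneg (x - y)]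
  · have h1 : logKernel (x - y) = ‖x - y‖⁻¹ := by simp [logKernel, h]
    rw [abs_of_nonpos (Real.log_nonpos (norm_nonneg _) h.le), h1, ← Real.log_inv]
    have := Real.log_le_self (inv_nonneg.mpr (norm_nonneg (x - y)))
    have : 0 ≤ (1 + ‖x‖) * (1 + ‖y‖) := by positivity
    linarith

theorem MemH1.integrable_pow_four {u : Plane → ℝ} (hu : MemH1 u) :
    Integrable fun x => u x ^ 4 := by
  have h := hu.integrable_rpow (p := (4 : ℕ)) (by norm_num)
  simp only [Real.rpow_natCast] at h
  simpa [Even.pow_abs (by decide : Even 4)] using h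

/-- The growing part of the majorant is a product of two weighted masses. For the singular part,
`u(x)² u(y)² ≤ u(x)⁴ + u(y)⁴` leaves integrands of convolutions of two `L¹` functions. -/
theorem integrable_log_interaction {α : ℝ} (hα : 1 ≤ α) {u : Plane → ℝ} (hu : u ∈ X α) :
    Integrable fun z : Plane × Plane => Real.log ‖z.1 - z.2‖ * u z.1 ^ 2 * u z.2 ^ 2 := by
  have hm : AEStronglyMeasurable u volume := hu.1.1.1
  have hw := integrable_one_add_norm_rpow_mul_sq zero_le_one hα hu
  simp only [Real.rpow_one] at hw
  have h4 := hu.1.integrable_pow_four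
  have hk2 : Integrable (fun z : Plane × Plane => u z.2 ^ 4 * logKernel (z.1 - z.2)) :=
    h4.convolution_integrand (ContinuousLinearMap.mul ℝ ℝ) integrable_logKernel
  have hk1 : Integrable (fun z : Plane × Plane => u z.1 ^ 4 * logKernel (z.1 - z.2)) := by
    refine (show Integrable _ (volume.prod volume) from hk2).swap.congr (ae_of_all _ fun z => ?_)
    simp only [Function.comp_apply, Prod.fst_swap, Prod.snd_swap]
    rw [← logKernel_neg, neg_sub]
  have hww : Integrable (fun z : Plane × Plane =>
      ((1 + ‖z.1‖) * u z.1 ^ 2) * ((1 + ‖z.2‖) * u z.2 ^ 2)) := hw.mul_prod hw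
  refine (hww.add (hk1.add hk2)).mono' ?_ (ae_of_all _ fun z => ?_)
  · have h1 : AEStronglyMeasurable (fun z : Plane × Plane => u z.1) volume := hm.comp_fst
    have h2 : AEStronglyMeasurable (fun z : Plane × Plane => u z.2) volume := hm.comp_snd
    exact (((by fun_prop : Measurable fun z : Plane × Plane =>
      Real.log ‖z.1 - z.2‖).aestronglyMeasurable).mul (h1.pow 2)).mul (h2.pow 2)
  · simp only [Pi.add_apply, norm_mul, norm_pow, Real.norm_eq_abs, sq_abs]
    have hk := logKernel_nonneg (z.1 - z.2)
    calc |Real.log ‖z.1 - z.2‖| * u z.1 ^ 2 * u z.2 ^ 2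
        ≤ ((1 + ‖z.1‖) * (1 + ‖z.2‖) + logKernel (z.1 - z.2)) * u z.1 ^ 2 * u z.2 ^ 2 := by
          gcongr
          exact abs_log_norm_sub_le _ _
      _ = (1 + ‖z.1‖) * u z.1 ^ 2 * ((1 + ‖z.2‖) * u z.2 ^ 2) +
          logKernel (z.1 - z.2) * (u z.1 ^ 2 * u z.2 ^ 2) := by ring
      _ ≤ (1 + ‖z.1‖) * u z.1 ^ 2 * ((1 + ‖z.2‖) * u z.2 ^ 2) +
          logKernel (z.1 - z.2) * (u z.1 ^ 4 + u z.2 ^ 4) := by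
          gcongr
          nlinarith [sq_nonneg (u z.1 ^ 2 - u z.2 ^ 2), sq_nonneg (u z.1 ^ 2),
            sq_nonneg (u z.2 ^ 2)]
      _ = _ := by ring

theorem V₀_le {α δ : ℝ} (hα : 1 ≤ α) (hδ : 0 < δ) (hδα : δ ≤ α) {u : Plane → ℝ} (hu : u ∈ X α) :
    V₀ u ≤ 1 / (2 * Real.pi * δ) * (∫ x, (1 + ‖x‖) ^ δ * u x ^ 2) ^ 2 := by
  have hw := integrable_one_add_norm_rpow_mul_sq hδ.le hδα hu
  have hww : Integrable (fun z : Plane × Plane =>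
      ((1 + ‖z.1‖) ^ δ * u z.1 ^ 2) * ((1 + ‖z.2‖) ^ δ * u z.2 ^ 2)) := hw.mul_prod hw
  have hle : ∫ z : Plane × Plane, Real.log ‖z.1 - z.2‖ * u z.1 ^ 2 * u z.2 ^ 2 ≤
      ∫ z : Plane × Plane,
        δ⁻¹ * (((1 + ‖z.1‖) ^ δ * u z.1 ^ 2) * ((1 + ‖z.2‖) ^ δ * u z.2 ^ 2)) := by
    refine integral_mono (integrable_log_interaction hα hu) (hww.const_mul δ⁻¹) fun z => ?_
    have h1 : Real.log ‖z.1 - z.2‖ ≤ δ⁻¹ * ((1 + ‖z.1‖) ^ δ * (1 + ‖z.2‖) ^ δ) := by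
      rw [← Real.mul_rpow (by positivity) (by positivity), ← div_eq_inv_mul]
      refine (Real.log_le_rpow_div (norm_nonneg _) hδ).trans ?_
      gcongr
      exact norm_sub_le_mul _ _
    calc Real.log ‖z.1 - z.2‖ * u z.1 ^ 2 * u z.2 ^ 2
        ≤ δ⁻¹ * ((1 + ‖z.1‖) ^ δ * (1 + ‖z.2‖) ^ δ) * u z.1 ^ 2 * u z.2 ^ 2 := by gcongr
      _ = _ := by ring
  rw [integral_const_mul] at hle
  have hprod := integral_prod_mul (μ := (volume : Measure Plane)) (ν := (volume : Measure Plane))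
    (fun x => (1 + ‖x‖) ^ δ * u x ^ 2) (fun x => (1 + ‖x‖) ^ δ * u x ^ 2)
  rw [← Measure.volume_eq_prod] at hprod
  rw [hprod] at hle
  calc V₀ u ≤ 1 / (2 * Real.pi) * (δ⁻¹ * ((∫ x, (1 + ‖x‖) ^ δ * u x ^ 2) *
        ∫ x, (1 + ‖x‖) ^ δ * u x ^ 2)) := by
        unfold V₀
        gcongr
    _ = _ := by field_simp

/-! ### The lower bound -/

/-- If `t^(p-4) ≥ pK(1+r)^β`, the power term dominates. Otherwise `t²` is bounded by a power of
`1+r`, and the left side is at most `K'(1+r)^γ t²` with `γ < α`: this is absorbed by `r^α t²/2` for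
large `r` and bounded for small `r`. -/
theorem exists_pow_four_le {p α β K : ℝ} (hp : 4 < p) (hβ : 0 ≤ β)
    (hβα : β * (p - 2) / (p - 4) < α) (hK : 0 ≤ K) :
    ∃ C R : ℝ, ∀ r t : ℝ, 0 ≤ r → 0 ≤ t → K * ((1 + r) ^ β * t ^ 4) ≤
      1 / 2 * ((1 + r ^ α) * t ^ 2) + 1 / p * t ^ p + (Set.Iic R).indicator (fun _ => C) r := by
  have hp4 : 0 < p - 4 := by linarith
  set γ := β * (p - 2) / (p - 4) with hγ
  have hγ0 : 0 ≤ γ := div_nonneg (mul_nonneg hβ (by linarith)) hp4.le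
  have hα : 0 < α := hγ0.trans_lt hβα
  set K' := K * (p * K) ^ (2 / (p - 4)) with hK'
  have hpK : 0 ≤ p * K := mul_nonneg (by linarith) hK
  have hK'0 : 0 ≤ K' := by positivity
  have hev : ∀ᶠ r : ℝ in atTop, K' * 2 ^ γ * r ^ (-(α - γ)) ≤ 1 / 2 := by
    have := (tendsto_rpow_neg_atTop (sub_pos.mpr hβα)).const_mul (K' * 2 ^ γ)
    rw [mul_zero] at this
    exact this.eventually_le_const (by norm_num)
  -- The threshold is raised to at least `1` so that `1 + r ≤ 2r` beyond it.
  obtain ⟨R, hR1, hR⟩ := (hev.exists_forall_of_atTop).imp fun a h =>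
    (show (1 : ℝ) ≤ max a 1 ∧ ∀ r ≥ max a 1, K' * 2 ^ γ * r ^ (-(α - γ)) ≤ 1 / 2 from
      ⟨le_max_right _ _, fun r hr => h r ((le_max_left _ _).trans hr)⟩)
  refine ⟨K' * (1 + max R 1) ^ γ * (p * K * (1 + max R 1) ^ β) ^ (2 / (p - 4)), max R 1,
    fun r t hr ht => ?_⟩
  set S := max R 1
  have hind : 0 ≤ (Set.Iic S).indicator
      (fun _ => K' * (1 + S) ^ γ * (p * K * (1 + S) ^ β) ^ (2 / (p - 4))) r :=
    Set.indicator_nonneg (fun _ _ => by positivity) r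
  have hrα : 0 ≤ r ^ α := Real.rpow_nonneg hr α
  rcases le_total (p * K * (1 + r) ^ β) (t ^ (p - 4)) with h | h
  · have htp : t ^ 4 * t ^ (p - 4) = t ^ p := by
      rw [← Real.rpow_natCast, ← Real.rpow_add_of_nonneg ht (by norm_num) hp4.le]
      norm_num
    have : K * ((1 + r) ^ β * t ^ 4) ≤ 1 / p * t ^ p := by
      rw [one_div, ← div_eq_inv_mul, le_div_iff₀ (by linarith), ← htp]
      calc K * ((1 + r) ^ β * t ^ 4) * p = t ^ 4 * (p * K * (1 + r) ^ β) := by ring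
        _ ≤ _ := by gcongr
    have h2 : 0 ≤ 1 / 2 * ((1 + r ^ α) * t ^ 2) := by positivity
    linarith
  · have ht2 : t ^ 2 ≤ (p * K * (1 + r) ^ β) ^ (2 / (p - 4)) := by
      calc t ^ 2 = (t ^ (p - 4)) ^ (2 / (p - 4)) := by
            rw [← Real.rpow_mul ht, mul_div_cancel₀ _ hp4.ne', Real.rpow_two]
        _ ≤ _ := by gcongr
    have hmain : K * ((1 + r) ^ β * t ^ 4) ≤ K' * (1 + r) ^ γ * t ^ 2 := by
      calc K * ((1 + r) ^ β * t ^ 4) = K * (1 + r) ^ β * t ^ 2 * t ^ 2 := by ring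
        _ ≤ K * (1 + r) ^ β * (p * K * (1 + r) ^ β) ^ (2 / (p - 4)) * t ^ 2 := by gcongr
        _ = _ := by
          rw [Real.mul_rpow hpK (by positivity), ← Real.rpow_mul (by positivity)]
          have : γ = β + β * (2 / (p - 4)) := by rw [hγ]; field_simp; ring
          rw [this, Real.rpow_add (by positivity), hK']
          ring
    have hpp : 0 ≤ 1 / p * t ^ p := by positivity
    rcases le_or_gt r S with hrS | hrS
    · rw [Set.indicator_of_mem (Set.mem_Iic.mpr hrS)]
      have : K' * (1 + r) ^ γ * t ^ 2 ≤
          K' * (1 + S) ^ γ * (p * K * (1 + S) ^ β) ^ (2 / (p - 4)) := by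
        refine mul_le_mul ?_ (ht2.trans ?_) (by positivity) (by positivity)
        · gcongr
        · gcongr
      have h2 : 0 ≤ 1 / 2 * ((1 + r ^ α) * t ^ 2) := by positivity
      linarith
    · have hr1 : 1 ≤ r := (le_max_right _ _).trans hrS.le
      have hr0 : 0 < r := by linarith
      have : K' * (1 + r) ^ γ ≤ 1 / 2 * (1 + r ^ α) := by
        calc K' * (1 + r) ^ γ ≤ K' * (2 * r) ^ γ := by gcongr; linarith
          _ = K' * 2 ^ γ * r ^ (-(α - γ)) * r ^ α := by
            rw [Real.mul_rpow (by norm_num) hr, mul_assoc (K' * 2 ^ γ), ← Real.rpow_add hr0]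
            ring_nf
          _ ≤ 1 / 2 * r ^ α := by
            gcongr
            exact hR r hrS.le
          _ ≤ _ := by linarith
      have := mul_le_mul_of_nonneg_right this (sq_nonneg t)
      linarith

theorem exists_le_I {p α q : ℝ} (hp : 4 < p) (hα : (2 * p - 4) / (p - 4) < α) (hq : 0 ≤ q) :
    ∃ M : ℝ, ∀ u ∈ X α, M ≤ I p q α u := by
  have hp4 : 0 < p - 4 := by linarith
  have hα2 : 2 < α := by
    refine lt_trans ?_ hα
    rw [lt_div_iff₀ hp4]
    linarith
  obtain ⟨δ, hδ, hδα, hβ⟩ : ∃ δ : ℝ, 0 < δ ∧ δ ≤ α ∧ (2 + 3 * δ) * (p - 2) / (p - 4) < α := by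
    rw [div_lt_iff₀ hp4] at hα
    have hpos : 0 < α * (p - 4) - (2 * p - 4) := by linarith
    -- With this `δ`, the extra `3δ(p-2)` uses at most half of the gap `α(p-4) - (2p-4)`.
    refine ⟨min 1 ((α * (p - 4) - (2 * p - 4)) / (6 * (p - 2))),
      lt_min one_pos (div_pos hpos (by linarith)), (min_le_left _ _).trans (by linarith), ?_⟩
    rw [div_lt_iff₀ hp4]
    have h := min_le_right 1 ((α * (p - 4) - (2 * p - 4)) / (6 * (p - 2)))
    rw [le_div_iff₀ (by linarith)] at h
    linarith
  set J := ∫ x : Plane, (1 + ‖x‖) ^ (-(2 + δ)) with hJ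
  have hJint : Integrable fun x : Plane => (1 + ‖x‖) ^ (-(2 + δ)) :=
    integrable_one_add_norm (by simp [hδ])
  have hJ0 : 0 ≤ J := integral_nonneg fun x => by positivity
  set c := q / 4 * (1 / (2 * Real.pi * δ)) with hc
  have hc0 : 0 ≤ c := by positivity
  -- The final `+ 1` gives `K ≥ 1`, so the pointwise bound also shows that the weighted `u⁴` is
  -- integrable.
  set K := c * (J + 1) + 1 with hK
  have hK1 : 1 ≤ K := by
    have : 0 ≤ c * (J + 1) := by positivity
    linarith
  obtain ⟨C, R, hpt⟩ := exists_pow_four_le hp (by positivity : 0 ≤ 2 + 3 * δ) hβ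
    (zero_le_one.trans hK1)
  have hbint : Integrable fun x : Plane => (Set.Iic R).indicator (fun _ => C) ‖x‖ := by
    have h : Integrable ((Metric.closedBall (0 : Plane) R).indicator fun _ => C) :=
      (integrable_indicator_iff measurableSet_closedBall).mpr
        (integrableOn_const measure_closedBall_lt_top.ne)
    refine h.congr (ae_of_all _ fun x => ?_)
    simp [Set.indicator]
  refine ⟨-∫ x : Plane, (Set.Iic R).indicator (fun _ => C) ‖x‖, fun u hu => ?_⟩
  have hm : AEStronglyMeasurable u volume := hu.1.1.1
  have hp_int := hu.1.integrable_rpow (p := p) (by linarith)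
  have hmaj : Integrable fun x => 1 / 2 * ((1 + ‖x‖ ^ α) * u x ^ 2) + 1 / p * |u x| ^ p +
      (Set.Iic R).indicator (fun _ => C) ‖x‖ :=
    ((hu.2.const_mul _).add (hp_int.const_mul _)).add hbint
  have hpt' : ∀ x, K * ((1 + ‖x‖) ^ (2 + 3 * δ) * u x ^ 4) ≤
      1 / 2 * ((1 + ‖x‖ ^ α) * u x ^ 2) + 1 / p * |u x| ^ p +
        (Set.Iic R).indicator (fun _ => C) ‖x‖ := by
    intro x
    have := hpt ‖x‖ |u x| (norm_nonneg x) (abs_nonneg _)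
    rwa [sq_abs, Even.pow_abs (by decide : Even 4)] at this
  have hS : Integrable fun x => (1 + ‖x‖) ^ (2 + 3 * δ) * u x ^ 4 := by
    refine hmaj.mono' ?_ (ae_of_all _ fun x => ?_)
    · exact (by fun_prop : Measurable fun x : Plane =>
        (1 + ‖x‖) ^ (2 + 3 * δ)).aestronglyMeasurable.mul (hm.pow 4)
    · have h0 : 0 ≤ (1 + ‖x‖) ^ (2 + 3 * δ) * u x ^ 4 := by positivity
      rw [Real.norm_of_nonneg h0]
      exact (le_mul_of_one_le_left h0 hK1).trans (hpt' x)
  have hT := integrable_one_add_norm_rpow_mul_sq hδ.le hδα hu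
  set S := ∫ x, (1 + ‖x‖) ^ (2 + 3 * δ) * u x ^ 4 with hSdef
  have hS0 : 0 ≤ S := integral_nonneg fun x => by positivity
  set T := ∫ x, (1 + ‖x‖) ^ δ * u x ^ 2 with hTdef
  have hTS : T ^ 2 ≤ (J + 1) * S := by
    -- Cauchy-Schwarz in linearised form, from integrating a square. Taking `s = T/(J+1)` instead of
    -- `T/J` avoids proving `J > 0`.
    have hs : ∀ s : ℝ, 2 * s * T ≤ S + s ^ 2 * J := by
      intro s
      rw [hTdef, hSdef, hJ, ← integral_const_mul, ← integral_const_mul,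
        ← integral_add hS (hJint.const_mul _)]
      refine integral_mono (hT.const_mul _) (hS.add (hJint.const_mul _)) fun x => ?_
      have ha : 0 < 1 + ‖x‖ := by positivity
      have e1 : (1 + ‖x‖) ^ (2 + 3 * δ) * u x ^ 4 =
          (1 + ‖x‖) ^ (2 + δ) * ((1 + ‖x‖) ^ δ * u x ^ 2) ^ 2 := by
        rw [mul_pow, ← Real.rpow_natCast ((1 + ‖x‖) ^ δ), ← Real.rpow_mul ha.le, ← mul_assoc,
          ← Real.rpow_add ha]
        push_cast
        ring_nf
      beta_reduce
      rw [e1, Real.rpow_neg ha.le]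
      have hb : 0 < (1 + ‖x‖) ^ (2 + δ) := by positivity
      set b := (1 + ‖x‖) ^ (2 + δ)
      set w := (1 + ‖x‖) ^ δ * u x ^ 2
      have : b * w ^ 2 + s ^ 2 * b⁻¹ - 2 * s * w = b⁻¹ * (b * w - s) ^ 2 := by
        field_simp; ring
      have : 0 ≤ b⁻¹ * (b * w - s) ^ 2 := by positivity
      linarith
    have h1 := hs (T / (J + 1))
    have h2 : (T / (J + 1)) ^ 2 * J ≤ (T / (J + 1)) ^ 2 * (J + 1) := by gcongr; linarith
    have h3 : (T / (J + 1)) ^ 2 * (J + 1) = T ^ 2 / (J + 1) := by field_simp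
    have h4 : 2 * (T / (J + 1)) * T = 2 * (T ^ 2 / (J + 1)) := by field_simp
    have h5 : T ^ 2 / (J + 1) ≤ S := by linarith
    rwa [div_le_iff₀ (by linarith), mul_comm] at h5
  have hV := V₀_le (by linarith : (1 : ℝ) ≤ α) hδ hδα hu
  have hqV : q / 4 * V₀ u ≤ K * S := by
    calc q / 4 * V₀ u ≤ q / 4 * (1 / (2 * Real.pi * δ) * T ^ 2) := by gcongr
      _ = c * T ^ 2 := by rw [hc]; ring
      _ ≤ c * ((J + 1) * S) := by gcongr
      _ ≤ K * S := by rw [hK]; linarith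
  have hKS : K * S ≤ 1 / 2 * (∫ x, (1 + ‖x‖ ^ α) * u x ^ 2) + 1 / p * (∫ x, |u x| ^ p) +
      ∫ x : Plane, (Set.Iic R).indicator (fun _ => C) ‖x‖ := by
    have hsum : Integrable fun x => 1 / 2 * ((1 + ‖x‖ ^ α) * u x ^ 2) + 1 / p * |u x| ^ p :=
      (hu.2.const_mul _).add (hp_int.const_mul _)
    rw [hSdef, ← integral_const_mul, ← integral_const_mul, ← integral_const_mul,
      ← integral_add (hu.2.const_mul _) (hp_int.const_mul _),
      ← integral_add hsum hbint]
    exact integral_mono (hS.const_mul _) hmaj hpt'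
  have hG : 0 ≤ ∫ x, ‖weakGradient u x‖ ^ 2 := integral_nonneg fun x => by positivity
  unfold I
  linarith

/-! ### Test functions with negative energy -/

theorem continuous_gradient {u : Plane → ℝ} (hu : ContDiff ℝ 1 u) : Continuous (∇ u) :=
  (InnerProductSpace.toDual ℝ Plane).symm.continuous.comp (hu.continuous_fderiv one_ne_zero)

/-- Integration by parts in each direction `e`; compact support of the test function kills the
boundary terms. -/
theorem hasWeakGradient_gradient {u : Plane → ℝ} (hu : ContDiff ℝ 1 u) :
    HasWeakGradient u (∇ u) := by
  refine ⟨hu.continuous.locallyIntegrable, (continuous_gradient hu).locallyIntegrable,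
    fun φ hφ hc => ?_⟩
  have hφ1 : ContDiff ℝ 1 φ := hφ.of_le (by simp)
  have hgc : HasCompactSupport (∇ φ) := (hc.fderiv ℝ).comp_left (map_zero _)
  have h1 : Integrable fun x => u x • ∇ φ x :=
    (hu.continuous.smul (continuous_gradient hφ1)).integrable_of_hasCompactSupport hgc.smul_left
  have h2 : Integrable fun x => φ x • ∇ u x :=
    (hφ.continuous.smul (continuous_gradient hu)).integrable_of_hasCompactSupport hc.smul_right
  refine ext_inner_left ℝ fun e => ?_
  rw [inner_neg_right, ← integral_inner h1, ← integral_inner h2]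
  have hin : ∀ (f : Plane → ℝ) x, inner ℝ e (∇ f x) = fderiv ℝ f x e := fun f x => by
    rw [real_inner_comm]; simp [gradient]
  simp only [inner_smul_right, hin]
  have hcu : Continuous fun x => fderiv ℝ u x e :=
    (hu.continuous_fderiv one_ne_zero).clm_apply continuous_const
  have hcφ : Continuous fun x => fderiv ℝ φ x e :=
    (hφ1.continuous_fderiv one_ne_zero).clm_apply continuous_const
  have := integral_mul_fderiv_eq_neg_fderiv_mul_of_integrable (μ := (volume : Measure Plane))
    (f := u) (g := φ) (v := e)
    ((hcu.mul hφ.continuous).integrable_of_hasCompactSupport hc.mul_left)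
    ((hu.continuous.mul hcφ).integrable_of_hasCompactSupport (hc.fderiv_apply ℝ e).mul_left)
    ((hu.continuous.mul hφ.continuous).integrable_of_hasCompactSupport hc.mul_left)
    (fun x _ => hu.differentiable one_ne_zero x) (fun x _ => hφ1.differentiable one_ne_zero x)
  rw [this]
  simp only [mul_comm]

theorem mem_X_of_contDiff {α : ℝ} (hα : 0 ≤ α) {u : Plane → ℝ} (hu : ContDiff ℝ 1 u)
    (hc : HasCompactSupport u) : u ∈ X α := by
  refine ⟨⟨hu.continuous.memLp_of_hasCompactSupport hc, ∇ u, hasWeakGradient_gradient hu,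
    (continuous_gradient hu).memLp_of_hasCompactSupport ((hc.fderiv ℝ).comp_left (map_zero _))⟩, ?_⟩
  have hcont : Continuous fun x : Plane => (1 + ‖x‖ ^ α) * u x ^ 2 :=
    (continuous_const.add (continuous_norm.rpow_const fun _ => Or.inr hα)).mul
      (hu.continuous.pow 2)
  refine hcont.integrable_of_hasCompactSupport (HasCompactSupport.mul_left ?_)
  exact hc.comp_left (g := fun t => t ^ 2) (by simp)

theorem dilated_bump_mem_Xr {α L : ℝ} (hα : 0 ≤ α) (hL : L ≠ 0) :
    (fun x => bump (L⁻¹ • x)) ∈ Xr α := by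
  refine ⟨mem_X_of_contDiff hα ((contDiff_bump.comp (contDiff_const_smul L⁻¹)).of_le (by simp))
    (hasCompactSupport_bump.comp_smul (inv_ne_zero hL)),
    fun r => Real.smoothTransition (2 - (‖L⁻¹‖ * r) ^ 2), ae_of_all _ fun x => ?_⟩
  simp [bump, norm_smul]

theorem integral_bump_sq_pos : 0 < ∫ x, bump x ^ 2 := by
  have hcont : Continuous fun x => bump x ^ 2 := contDiff_bump.continuous.pow 2
  refine hcont.integral_pos_of_hasCompactSupport_nonneg_nonzero (x := 0)
    (hasCompactSupport_bump.comp_left (g := fun t => t ^ 2) (by simp))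
    (fun x => sq_nonneg _) ?_
  simp [bump_eq_one (x := 0) (by simp)]

theorem ae_prod_sub_ne_zero : ∀ᵐ z : Plane × Plane, z.1 - z.2 ≠ 0 :=
  (quasiMeasurePreserving_sub (volume : Measure Plane) volume).ae
    (p := fun x => x ≠ 0) (by simp [ae_iff])

theorem exists_mem_Xr_V₀_pos {α : ℝ} (hα : 1 ≤ α) : ∃ u ∈ Xr α, 0 < V₀ u := by
  have hα0 : 0 ≤ α := by linarith
  have hb : bump ∈ X α := mem_X_of_contDiff hα0 (contDiff_bump.of_le (by simp))
    hasCompactSupport_bump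
  set V := ∫ z : Plane × Plane, Real.log ‖z.1 - z.2‖ * bump z.1 ^ 2 * bump z.2 ^ 2
  set m := ∫ x, bump x ^ 2
  have hm : 0 < m := integral_bump_sq_pos
  obtain ⟨s, hs⟩ : ∃ s : ℝ, 0 < s * m ^ 2 + V :=
    ⟨(1 - V) / m ^ 2, by field_simp; linarith⟩
  set L := Real.exp s
  have hL : 0 < L := Real.exp_pos s
  refine ⟨fun x => bump (L⁻¹ • x), dilated_bump_mem_Xr hα0 hL.ne', ?_⟩
  have hbb : Integrable fun z : Plane × Plane => bump z.1 ^ 2 * bump z.2 ^ 2 :=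
    hb.1.1.integrable_sq.mul_prod hb.1.1.integrable_sq
  have hprod : ∫ z : Plane × Plane, bump z.1 ^ 2 * bump z.2 ^ 2 = m ^ 2 := by
    have := integral_prod_mul (μ := (volume : Measure Plane)) (ν := (volume : Measure Plane))
      (fun x => bump x ^ 2) (fun x => bump x ^ 2)
    rw [← Measure.volume_eq_prod] at this
    rw [this, sq]
  -- Off the diagonal, a null set, `log ‖L • w‖ = s + log ‖w‖`. The later change of variables only
  -- adds a positive Jacobian.
  have hG : ∫ z : Plane × Plane,
      Real.log ‖L • (z.1 - z.2)‖ * bump z.1 ^ 2 * bump z.2 ^ 2 = s * m ^ 2 + V := by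
    rw [← hprod, ← integral_const_mul,
      ← integral_add (hbb.const_mul s) (integrable_log_interaction hα hb)]
    refine integral_congr_ae ?_
    filter_upwards [ae_prod_sub_ne_zero] with z hz
    rw [norm_smul, Real.log_mul (norm_ne_zero_iff.mpr hL.ne') (norm_ne_zero_iff.mpr hz),
      Real.norm_of_nonneg hL.le, Real.log_exp]
    ring
  have : (volume : Measure (Plane × Plane)).IsAddHaarMeasure :=
    inferInstanceAs ((volume : Measure Plane).prod volume).IsAddHaarMeasure
  have hscale := Measure.integral_comp_smul (volume : Measure (Plane × Plane))
    (fun z => Real.log ‖L • (z.1 - z.2)‖ * bump z.1 ^ 2 * bump z.2 ^ 2) L⁻¹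
  simp only [Prod.smul_fst, Prod.smul_snd, ← smul_sub, smul_inv_smul₀ hL.ne'] at hscale
  rw [hG] at hscale
  unfold V₀
  rw [hscale]
  have : 0 < |(L⁻¹ ^ Module.finrank ℝ (Plane × Plane))⁻¹| := by positivity
  have := Real.pi_pos
  rw [smul_eq_mul]
  positivity

theorem MemH1.integrable_norm_weakGradient_sq {u : Plane → ℝ} (hu : MemH1 u) :
    Integrable fun x => ‖weakGradient u x‖ ^ 2 := by
  obtain ⟨-, g, hg, hg2⟩ := hu
  have h : MemLp (weakGradient u) 2 := hg2.ae_eq hg.weakGradient_ae_eq.symm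
  exact h.integrable_norm_pow two_ne_zero

end PlanarSchrodingerMaxwell

/-- The infimum is taken in `EReal`, where being above `⊥` does express boundedness below and an `u`
outside `Xr α` contributes `⊤`. -/
theorem lemma3p3 (p α : ℝ) (hp : 4 < p) (hα : (2 * p - 4) / (p - 4) < α) :
    (∀ u ∈ PlanarSchrodingerMaxwell.Xr α,
      Integrable (fun x => ‖PlanarSchrodingerMaxwell.weakGradient u x‖ ^ 2) ∧
      Integrable (fun x => (1 + ‖x‖ ^ α) * u x ^ 2) ∧
      Integrable (fun z : PlanarSchrodingerMaxwell.Plane × PlanarSchrodingerMaxwell.Plane =>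
        Real.log ‖z.1 - z.2‖ * u z.1 ^ 2 * u z.2 ^ 2) ∧
      Integrable (fun x => |u x| ^ p)) ∧
    ∃ q₀ : ℝ, 0 < q₀ ∧ ∀ q : ℝ, q₀ ≤ q →
      (⨅ u ∈ PlanarSchrodingerMaxwell.Xr α,
        ((PlanarSchrodingerMaxwell.I p q α u : ℝ) : EReal)) ∈ Set.Ioo (⊥ : EReal) 0 := by
  have hα1 : 1 ≤ α := by
    refine le_trans ?_ hα.le
    rw [le_div_iff₀ (by linarith)]
    linarith
  refine ⟨fun u hu => ⟨hu.1.1.integrable_norm_weakGradient_sq, hu.1.2,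
    PlanarSchrodingerMaxwell.integrable_log_interaction hα1 hu.1,
    hu.1.1.integrable_rpow (by linarith)⟩, ?_⟩
  obtain ⟨u, hu, hV⟩ := PlanarSchrodingerMaxwell.exists_mem_Xr_V₀_pos hα1
  set V := PlanarSchrodingerMaxwell.V₀ u with hVdef
  set A := PlanarSchrodingerMaxwell.I p 0 α u with hA
  -- The energy of `u` is `A - qV/4`, negative once `q > 4A/V`; the absolute value and `+ 1` make
  -- the threshold positive and the inequality strict.
  refine ⟨|4 * A / V| + 1, by positivity, fun q hq => ⟨?_, ?_⟩⟩
  · obtain ⟨M, hM⟩ := PlanarSchrodingerMaxwell.exists_le_I hp hα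
      (show 0 ≤ q from le_trans (by positivity) hq)
    exact (EReal.bot_lt_coe M).trans_le
      (le_iInf₂ fun w hw => EReal.coe_le_coe_iff.mpr (hM w hw.1))
  · refine (iInf₂_le u hu).trans_lt ?_
    rw [← EReal.coe_zero, EReal.coe_lt_coe_iff]
    have h1 : 4 * A / V < q := by linarith [le_abs_self (4 * A / V)]
    rw [div_lt_iff₀ hV] at h1
    have h2 : PlanarSchrodingerMaxwell.I p q α u = A - q / 4 * V := by
      rw [hA, hVdef, PlanarSchrodingerMaxwell.I, PlanarSchrodingerMaxwell.I]
      ring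
    rw [h2]
    linarith
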